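/- Let $d\ge 1$. For $\lambda>0$ and a probability measure $\rho$ on $[0,\infty)$ let $\chi$ be a Poisson point process on $\mathbb{R}^d\times[0,\infty)$ with intensity measure $(\lambda\,\mathrm{Leb}_d)\otimes\rho$, let $\mathbb{P}_{\lambda,\rho}$ be its law, and let $$\Sigma=\bigcup_{(x,r)\in\chi}\mathcal{B}(x,r)$$ be the occupied set of the Boolean model, where $\mathcal{B}(x,r)$ is the open Euclidean ball with center $x$ and radius $r$. For $y\in\Sigma$ let $C(y)$ be the cluster of $y$, that is, the set of all points that can be joined to $y$ by a continuous path in $\Sigma$; put $C(y)=\emptyset$ for $y\notin\Sigma$. For an integer $N\ge 1$ let $\mathrm{CROSS}(N,3N,\dots,3N)$ be the event that the box $[0,N]\times[0,3N]^{d-1}$ contains a path-connected subset of $\Sigma$ that meets both $\{0\}\times[0,3N]^{d-1}$ and $\{N\}\times[0,3N]^{d-1}$. For every $C>0$ there is $\varepsilon=\varepsilon(C,d)>0$ such that the following holds. Let $N\ge 1$ be an integer, let $\lambda>0$, and let $\rho$ be a probability measure on $[0,\infty)$ for which there is $R_0>0$ with $\rho([R,\infty))\le e^{-CR}$ for all $R\ge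 R_0$. If $$\mathbb{P}_{\lambda,\rho}\big(\mathrm{CROSS}(N,3N,\dots,3N)\big)\le\varepsilon,$$ then $$\mathbb{P}_{\lambda,\rho}\big(\exists\, y\in\mathbb{R}^d:\ \mathrm{Leb}_d(C(y))=\infty\big)=0.$$ -/

import Mathlib

open MeasureTheory ProbabilityTheory
open scoped NNReal ENNReal

noncomputable section

namespace BooleanModel

/-- A random set of points `χ : Ω → Set X`, on a space `Ω` with probability `P`, is a Poisson point
process with the (diffuse, σ-finite) intensity measure `ν`: the number `#(χ ∩ A)` of points in a
measurable set `A` is a random variable; it has the Poisson law with parameter `ν A` when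
`ν A < ∞`; and the numbers of points in finitely many pairwise disjoint sets are independent. -/
structure IsPoissonPointProcess {Ω X : Type*} [MeasurableSpace Ω] [MeasurableSpace X]
    (P : Measure Ω) (ν : Measure X) (χ : Ω → Set X) : Prop where
  measurable_count : ∀ A : Set X, MeasurableSet A →
    Measurable (fun ω => (χ ω ∩ A).encard)
  law_count : ∀ A : Set X, MeasurableSet A → ν A ≠ ∞ →
    P.map (fun ω => (χ ω ∩ A).encard)
      = (poissonMeasure (ν A).toNNReal).map (Nat.cast : ℕ → ℕ∞)
  indep_count : ∀ (n : ℕ) (A : Fin n → Set X), (∀ i, MeasurableSet (A i)) →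
    Pairwise (fun i j => Disjoint (A i) (A j)) →
    iIndepFun (fun i ω => (χ ω ∩ A i).encard) P

/-- The intensity measure `(lam × Leb_d) ⊗ ρ` on `ℝ^d × [0,∞)`. -/
def intensity (d : ℕ) (lam : ℝ) (ρ : Measure ℝ≥0) :
    Measure (EuclideanSpace ℝ (Fin d) × ℝ≥0) :=
  (ENNReal.ofReal lam • (volume : Measure (EuclideanSpace ℝ (Fin d)))).prod ρ

/-- The set covered by a configuration of points `(x, r)`, each of which stands for the open
Euclidean ball with center `x` and radius `r`. -/
def occupied {d : ℕ} (c : Set (EuclideanSpace ℝ (Fin d) × ℝ≥0)) :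
    Set (EuclideanSpace ℝ (Fin d)) :=
  ⋃ p ∈ c, Metric.ball p.1 (p.2 : ℝ)

/-- The cluster of `S` that contains `y`: all points that can be joined to `y` by a continuous path
in `S`. It is empty when `y ∉ S`. -/
def cluster {d : ℕ} (S : Set (EuclideanSpace ℝ (Fin d))) (y : EuclideanSpace ℝ (Fin d)) :
    Set (EuclideanSpace ℝ (Fin d)) :=
  pathComponentIn S y

/-- The box `[0, L 0] × ⋯ × [0, L (d-1)]`. -/
def box {d : ℕ} (L : Fin d → ℝ) : Set (EuclideanSpace ℝ (Fin d)) :=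
  {x | ∀ i, 0 ≤ x i ∧ x i ≤ L i}

/-- The left-right crossing property: the box with side lengths `L` contains a path-connected
subset `A` of `S` that meets both faces of the box orthogonal to the first coordinate direction. -/
def Cross {d : ℕ} [NeZero d] (S : Set (EuclideanSpace ℝ (Fin d))) (L : Fin d → ℝ) : Prop :=
  ∃ A : Set (EuclideanSpace ℝ (Fin d)), A ⊆ S ∧ A ⊆ box L ∧ IsPathConnected A ∧
    (∃ x ∈ A, x 0 = 0) ∧ (∃ x ∈ A, x 0 = L 0)

/-- The side lengths `(N, 3N, …, 3N)`. -/
def sides (d : ℕ) [NeZero d] (N : ℕ) : Fin d → ℝ :=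
  fun i => if i = 0 then (N : ℝ) else 3 * (N : ℝ)

end BooleanModel

end

open Set Filter Topology

namespace BooleanModel

/-! The proof is a renormalisation of the annulus events `Arm z m`. If `Arm 0 (10 * m)` occurs, then
either a grain of radius at least `m` has its center within `31` times its radius of the origin, or
the grains of radius below `m` already produce arms of scale `m` around a net point of radius `10 *
m` and around one of radius `20 * m`. Those two arms involve disjoint sets of grains, hence are
independent. So the arm probability satisfies p(10m) ≤ g(m) + K p(m)², where g(m) is the intensity
of large grains (`measure_arm_step`), and it tends to zero along the scales once p and g are small
at the first scale.

The crossing hypothesis provides both. At scale `6 * d * N` an arm forces one of boundedly many tube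
crossings, each at most as likely as a crossing of the box (`exists_measure_arm_le_card_mul`). A
grain of radius at least `6 * d * N` centered within half its radius of the origin covers the whole
box, so such grains have small intensity; homogeneity (`intensity_nearGrains`) passes from the
factor `1 / 2` to `31`. As g is then finite, it tends to zero along the scales.

Finally, a cluster of infinite volume containing a point near the origin leaves every ball, hence
forces an arm at all large scales. -/

/-- Point configurations in `X`. -/
def Configuration (X : Type*) : Type _ := Set X

/-! ### Configurations, void events and laws with Poisson void probabilities -/

section Configurations

variable {X : Type*}

/-- The configurations without points in `A`. -/
def voidEvent (A : Set X) : Set (Configuration X) := {c | Disjoint (show Set X from c) A}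

lemma voidEvent_inter (A B : Set X) : voidEvent A ∩ voidEvent B = voidEvent (A ∪ B) := by
  ext c
  exact (disjoint_union_right (s := show Set X from c) (t := A) (u := B)).symm

lemma mem_compl_voidEvent {A : Set X} {c : Configuration X} :
    c ∈ (voidEvent A)ᶜ ↔ ∃ p ∈ (show Set X from c), p ∈ A := by
  change ¬ Disjoint (show Set X from c) A ↔ _
  rw [not_disjoint_iff]

lemma setOf_disjoint_eq {Ω : Type*} (χ : Ω → Set X) (A : Set X) :
    {ω | Disjoint (χ ω) A} = (fun ω => (χ ω ∩ A).encard) ⁻¹' {0} := by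
  ext ω
  simp [disjoint_iff_inter_eq_empty]

variable [MeasurableSpace X]

/-- The void events of the measurable subsets of `Z`. -/
def voidEvents (Z : Set X) : Set (Set (Configuration X)) :=
  {s | ∃ A, MeasurableSet A ∧ A ⊆ Z ∧ s = voidEvent A}

lemma isPiSystem_voidEvents (Z : Set X) : IsPiSystem (voidEvents Z) := by
  rintro _ ⟨A, hA, hAZ, rfl⟩ _ ⟨B, hB, hBZ, rfl⟩ -
  exact ⟨A ∪ B, hA.union hB, union_subset hAZ hBZ, voidEvent_inter A B⟩

/-- The `σ`-algebra of the events that depend only on the points in `Z`. -/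
@[reducible]
def localSigma (Z : Set X) : MeasurableSpace (Configuration X) :=
  MeasurableSpace.generateFrom (voidEvents Z)

instance : MeasurableSpace (Configuration X) := localSigma univ

lemma localSigma_mono {Z Z' : Set X} (h : Z ⊆ Z') : localSigma Z ≤ localSigma Z' :=
  MeasurableSpace.generateFrom_mono fun _ ⟨A, hA, hAZ, hs⟩ => ⟨A, hA, hAZ.trans h, hs⟩

lemma localSigma_le (Z : Set X) :
    localSigma Z ≤ (inferInstance : MeasurableSpace (Configuration X)) :=
  localSigma_mono (subset_univ Z)

lemma measurableSet_voidEvent_localSigma {Z A : Set X} (hA : MeasurableSet A) (hAZ : A ⊆ Z) :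
    MeasurableSet[localSigma Z] (voidEvent A) :=
  MeasurableSpace.measurableSet_generateFrom ⟨A, hA, hAZ, rfl⟩

lemma measurableSet_voidEvent {A : Set X} (hA : MeasurableSet A) :
    MeasurableSet (voidEvent A) :=
  measurableSet_voidEvent_localSigma hA (subset_univ A)

/-- The probability `exp (-a)` that a Poisson variable with mean `a` vanishes. -/
noncomputable def voidProb (a : ℝ≥0∞) : ℝ≥0∞ :=
  if a = ∞ then 0 else ENNReal.ofReal (Real.exp (-a.toReal))

lemma voidProb_add (a b : ℝ≥0∞) : voidProb (a + b) = voidProb a * voidProb b := by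
  unfold voidProb
  by_cases ha : a = ∞
  · simp [ha]
  by_cases hb : b = ∞
  · simp [hb]
  rw [if_neg (by simp [ha, hb]), if_neg ha, if_neg hb, ENNReal.toReal_add ha hb, neg_add,
    Real.exp_add, ENNReal.ofReal_mul (Real.exp_pos _).le]

lemma one_sub_voidProb_le (a : ℝ≥0∞) : 1 - voidProb a ≤ a := by
  unfold voidProb
  split_ifs with ha
  · simp [ha]
  rw [← ENNReal.ofReal_one, ← ENNReal.ofReal_sub _ (Real.exp_pos _).le]
  refine ENNReal.ofReal_le_of_le_toReal ?_
  linarith [Real.add_one_le_exp (-a.toReal)]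

/-- This turns a small probability of seeing a point in a set into a small intensity of that set. It
rests on exp(-2e) ≤ 1/(1 + 2e) ≤ 1 - e for 0 ≤ e ≤ 1/2. -/
lemma le_of_one_sub_voidProb_le {a : ℝ≥0∞} {e : ℝ} (he : e ≤ 1 / 2)
    (h : 1 - voidProb a ≤ ENNReal.ofReal e) : a ≤ ENNReal.ofReal (2 * e) := by
  unfold voidProb at h
  split_ifs at h with ha
  · rw [tsub_zero, ENNReal.one_le_ofReal] at h
    linarith
  rw [← ENNReal.ofReal_one, ← ENNReal.ofReal_sub _ (Real.exp_pos _).le] at h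
  rw [← ENNReal.ofReal_toReal ha]
  have ha0 : 0 ≤ a.toReal := ENNReal.toReal_nonneg
  have he1 : 0 ≤ 1 - Real.exp (-a.toReal) := by
    have : Real.exp (-a.toReal) ≤ 1 := Real.exp_le_one_iff.2 (by linarith)
    linarith
  rcases lt_or_ge e 0 with hneg | hpos
  · rw [ENNReal.ofReal_of_nonpos hneg.le, nonpos_iff_eq_zero, ENNReal.ofReal_eq_zero] at h
    have h0 : Real.exp (-a.toReal) = Real.exp 0 := by rw [Real.exp_zero]; linarith
    have h1 := Real.exp_injective h0
    rw [show a.toReal = 0 by linarith]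
    simp
  refine ENNReal.ofReal_le_ofReal ?_
  rw [ENNReal.ofReal_le_ofReal_iff hpos] at h
  by_contra! hlt
  have h1 : Real.exp (-a.toReal) < Real.exp (-(2 * e)) := Real.exp_lt_exp.2 (by linarith)
  have h2 : Real.exp (-(2 * e)) ≤ 1 - e := by
    have h3 : 1 + 2 * e ≤ Real.exp (2 * e) := by linarith [Real.add_one_le_exp (2 * e)]
    rw [Real.exp_neg]
    refine (inv_anti₀ (by positivity) h3).trans ?_
    rw [inv_le_iff_one_le_mul₀ (by positivity)]
    nlinarith
  linarith

/-- A law on configurations with the void probabilities of a Poisson process. -/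
structure HasPoissonVoids (μ : Measure (Configuration X)) (ν : Measure X) : Prop where
  isProbabilityMeasure : IsProbabilityMeasure μ
  apply_voidEvent : ∀ A, MeasurableSet A → μ (voidEvent A) = voidProb (ν A)

namespace HasPoissonVoids

variable {μ : Measure (Configuration X)} {ν : Measure X}

lemma apply_compl_voidEvent (h : HasPoissonVoids μ ν) {A : Set X} (hA : MeasurableSet A) :
    μ (voidEvent A)ᶜ = 1 - voidProb (ν A) := by
  have := h.isProbabilityMeasure
  rw [prob_compl_eq_one_sub (measurableSet_voidEvent hA), h.apply_voidEvent A hA]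

lemma apply_compl_voidEvent_le (h : HasPoissonVoids μ ν) {A : Set X} (hA : MeasurableSet A) :
    μ (voidEvent A)ᶜ ≤ ν A :=
  (h.apply_compl_voidEvent hA).trans_le (one_sub_voidProb_le _)

/-- Void events form π-systems generating the two σ-algebras, and void probabilities multiply
because the intensity adds over disjoint sets. -/
lemma indep (h : HasPoissonVoids μ ν) {Z₁ Z₂ : Set X} (hZ : Disjoint Z₁ Z₂) :
    Indep (localSigma Z₁) (localSigma Z₂) μ := by
  have := h.isProbabilityMeasure
  refine IndepSets.indep (localSigma_le _) (localSigma_le _) (isPiSystem_voidEvents Z₁)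
    (isPiSystem_voidEvents Z₂) rfl rfl ?_
  rw [IndepSets_iff]
  rintro _ _ ⟨A, hA, hAZ, rfl⟩ ⟨B, hB, hBZ, rfl⟩
  rw [voidEvent_inter, h.apply_voidEvent _ (hA.union hB), h.apply_voidEvent _ hA,
    h.apply_voidEvent _ hB, measure_union (hZ.mono hAZ hBZ) hB, voidProb_add]

/-- The law is invariant under the preimage map of a measure preserving bijection. -/
lemma measure_preimage_eq (h : HasPoissonVoids μ ν) (S : X ≃ᵐ X) (hS : MeasurePreserving S ν ν)
    {s : Set (Configuration X)} (hs : MeasurableSet s) :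
    μ {c | (show Configuration X from S ⁻¹' (show Set X from c)) ∈ s} = μ s := by
  have := h.isProbabilityMeasure
  let F : Configuration X → Configuration X := fun c => S ⁻¹' (show Set X from c)
  have hvoid : ∀ A, F ⁻¹' voidEvent A = voidEvent (S '' A) := fun A => by
    ext c
    change Disjoint (S ⁻¹' (show Set X from c)) A ↔ Disjoint (show Set X from c) (S '' A)
    rw [disjoint_image_right]
  have hF : Measurable F := by
    refine measurable_generateFrom ?_
    rintro _ ⟨A, hA, -, rfl⟩
    rw [hvoid]
    exact measurableSet_voidEvent (S.measurableSet_image.2 hA)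
  have hmap : μ.map F = μ := by
    have : IsProbabilityMeasure (μ.map F) := Measure.isProbabilityMeasure_map hF.aemeasurable
    refine ext_of_generate_finite (voidEvents univ) rfl (isPiSystem_voidEvents _) ?_ (by simp)
    rintro _ ⟨A, hA, -, rfl⟩
    rw [Measure.map_apply hF (measurableSet_voidEvent hA), hvoid,
      h.apply_voidEvent _ (S.measurableSet_image.2 hA), h.apply_voidEvent _ hA,
      S.image_eq_preimage_symm, (hS.symm S).measure_preimage hA.nullMeasurableSet]
  change μ (F ⁻¹' s) = μ s
  rw [← Measure.map_apply hF hs, hmap]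

end HasPoissonVoids

section PointProcess

variable {Ω : Type*} [MeasurableSpace Ω] {P : Measure Ω} {ν : Measure X} {χ : Ω → Set X}

namespace IsPoissonPointProcess

lemma measurableSet_disjoint (h : IsPoissonPointProcess P ν χ) {A : Set X}
    (hA : MeasurableSet A) : MeasurableSet {ω | Disjoint (χ ω) A} := by
  rw [setOf_disjoint_eq]
  exact h.measurable_count A hA (measurableSet_singleton 0)

lemma measurable (h : IsPoissonPointProcess P ν χ) :
    Measurable (fun ω => (show Configuration X from χ ω)) := by
  refine measurable_generateFrom ?_
  rintro _ ⟨A, hA, -, rfl⟩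
  exact h.measurableSet_disjoint hA

lemma measure_disjoint_of_ne_top (h : IsPoissonPointProcess P ν χ) {A : Set X}
    (hA : MeasurableSet A) (hν : ν A ≠ ∞) :
    P {ω | Disjoint (χ ω) A} = ENNReal.ofReal (Real.exp (-(ν A).toReal)) := by
  rw [setOf_disjoint_eq, ← Measure.map_apply (h.measurable_count A hA) (measurableSet_singleton 0),
    h.law_count A hA hν, Measure.map_apply (measurable_of_countable _) (measurableSet_singleton 0)]
  have : (Nat.cast : ℕ → ℕ∞) ⁻¹' {0} = {0} := by ext n; simp
  rw [this, poissonMeasure_singleton, pow_zero, mul_one, Nat.factorial_zero, Nat.cast_one, div_one]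
  rfl

lemma measure_disjoint [SigmaFinite ν] (h : IsPoissonPointProcess P ν χ) {A : Set X}
    (hA : MeasurableSet A) : P {ω | Disjoint (χ ω) A} = voidProb (ν A) := by
  unfold voidProb
  split_ifs with hν
  swap
  · exact h.measure_disjoint_of_ne_top hA hν
  -- The Poisson law is prescribed only for finite intensity, so a set of infinite intensity is
  -- exhausted by sets of finite intensity.
  have hlim : Tendsto (fun n => ν (A ∩ spanningSets ν n)) atTop (𝓝 ∞) := by
    have := tendsto_measure_iUnion_atTop (μ := ν) (s := fun n => A ∩ spanningSets ν n)
      (fun _ _ hmn => inter_subset_inter_right _ (monotone_spanningSets ν hmn))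
    rwa [← inter_iUnion, iUnion_spanningSets, inter_univ, hν] at this
  have hle : ∀ M : ℝ, P {ω | Disjoint (χ ω) A} ≤ ENNReal.ofReal (Real.exp (-M)) := fun M => by
    obtain ⟨n, hn⟩ := (hlim.eventually (lt_mem_nhds (b := ∞) (a := ENNReal.ofReal M)
      ENNReal.ofReal_lt_top)).exists
    have hfin : ν (A ∩ spanningSets ν n) ≠ ∞ :=
      ((measure_mono inter_subset_right).trans_lt (measure_spanningSets_lt_top ν n)).ne
    calc P {ω | Disjoint (χ ω) A} ≤ P {ω | Disjoint (χ ω) (A ∩ spanningSets ν n)} :=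
          measure_mono fun ω hω => Disjoint.mono_right inter_subset_left hω
      _ = _ := h.measure_disjoint_of_ne_top (hA.inter (measurableSet_spanningSets ν n)) hfin
      _ ≤ _ := by
          refine ENNReal.ofReal_le_ofReal (Real.exp_le_exp.2 (neg_le_neg ?_))
          exact (ENNReal.ofReal_le_iff_le_toReal hfin).1 hn.le
  have hzero : Tendsto (fun M : ℝ => ENNReal.ofReal (Real.exp (-M))) atTop (𝓝 0) := by
    simpa using ENNReal.tendsto_ofReal Real.tendsto_exp_neg_atTop_nhds_zero
  exact le_antisymm (ge_of_tendsto' hzero hle) zero_le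

/-- Void probabilities are all that the argument needs from the Poisson process: they yield both
independence and invariance. -/
lemma hasPoissonVoids [SigmaFinite ν] [IsProbabilityMeasure P]
    (h : IsPoissonPointProcess P ν χ) :
    HasPoissonVoids (P.map fun ω => (show Configuration X from χ ω)) ν where
  isProbabilityMeasure := Measure.isProbabilityMeasure_map h.measurable.aemeasurable
  apply_voidEvent A hA := by
    rw [Measure.map_apply h.measurable (measurableSet_voidEvent hA)]
    exact h.measure_disjoint hA

end IsPoissonPointProcess

end PointProcess

end Configurations

end BooleanModel

/-! ### Cutting paths at level sets -/

/-- An intermediate value along a path, together with the part of the path before it is reached. -/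
lemma JoinedIn.exists_eq_of_le_of_le {Y : Type*} [TopologicalSpace Y] {F : Set Y} {a b : Y}
    (h : JoinedIn F a b) {f : Y → ℝ} (hf : Continuous f) {s : ℝ} (ha : f a ≤ s) (hb : s ≤ f b) :
    ∃ p, f p = s ∧ JoinedIn (F ∩ {x | f x ≤ s}) a p := by
  obtain ⟨γ, hγ⟩ := h
  let g : ℝ → ℝ := fun t => f (γ.extend t)
  have hg : Continuous g := hf.comp γ.continuous_extend
  have hγF : ∀ t, γ.extend t ∈ F := fun t => by
    have : γ.extend t ∈ range γ := by rw [← γ.extend_range]; exact mem_range_self t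
    obtain ⟨u, hu⟩ := this
    exact hu ▸ hγ u
  let D : Set ℝ := Icc 0 1 ∩ g ⁻¹' {s}
  have hDne : D.Nonempty := by
    obtain ⟨t, ht, hts⟩ := intermediate_value_Icc (zero_le_one' ℝ) hg.continuousOn
      (show s ∈ Icc (g 0) (g 1) by simp [g, ha, hb])
    exact ⟨t, ht, hts⟩
  have hDc : IsCompact D := isCompact_Icc.inter_right (isClosed_singleton.preimage hg)
  -- At the first hitting time of `s`, no earlier value exceeds `s`, since it would force an earlier
  -- hit.
  obtain ⟨t, ⟨ht, hts⟩, hmin⟩ := hDc.exists_isLeast hDne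
  refine ⟨γ.extend t, hts, ?_⟩
  have hle : ∀ u ∈ Icc 0 t, g u ≤ s := by
    intro u hu
    by_contra! hlt
    obtain ⟨v, hv, hvs⟩ := intermediate_value_Icc hu.1 hg.continuousOn
      (show s ∈ Icc (g 0) (g u) from ⟨by simp [g, ha], hlt.le⟩)
    have hvD : t ≤ v := hmin ⟨⟨hv.1, hv.2.trans (hu.2.trans ht.2)⟩, hvs⟩
    have : v = u := le_antisymm hv.2 (hu.2.trans hvD)
    rw [this] at hvs
    exact hlt.ne' hvs
  have hpc : IsPathConnected (γ.extend '' Icc 0 t) :=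
    ((convex_Icc 0 t).isPathConnected ⟨0, left_mem_Icc.2 ht.1⟩).image γ.continuous_extend
  have hj := hpc.joinedIn a ⟨0, left_mem_Icc.2 ht.1, by simp⟩ (γ.extend t)
    ⟨t, right_mem_Icc.2 ht.1, rfl⟩
  refine hj.mono ?_
  rintro _ ⟨u, hu, rfl⟩
  exact ⟨hγF u, hle u hu⟩

/-- A piece of a path along which a function runs between two given values. -/
lemma JoinedIn.exists_crossing {Y : Type*} [TopologicalSpace Y] {F : Set Y} {a b : Y}
    (h : JoinedIn F a b) {f : Y → ℝ} (hf : Continuous f) {s t : ℝ} (ha : f a ≤ s) (hst : s ≤ t)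
    (hb : t ≤ f b) :
    ∃ p q, f p = s ∧ f q = t ∧ JoinedIn (F ∩ {x | s ≤ f x ∧ f x ≤ t}) p q := by
  obtain ⟨q, hq, hj⟩ := h.exists_eq_of_le_of_le hf (ha.trans hst) hb
  -- Reversing the path and negating `f` cuts at the last visit to `s`.
  obtain ⟨p, hp, hj'⟩ := hj.symm.exists_eq_of_le_of_le (f := fun x => -f x) hf.neg (s := -s)
    (by linarith) (by linarith)
  refine ⟨p, q, by linarith, hq, hj'.symm.mono ?_⟩
  rintro x ⟨⟨hxF, hxt⟩, hxs⟩
  exact ⟨hxF, by simpa using hxs, hxt⟩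

/-! ### Measurability of connection events -/

lemma measurableSet_reflTransGen {α ι : Type*} [MeasurableSpace α] [Countable ι]
    {R : α → ι → ι → Prop} (hR : ∀ i j, MeasurableSet {a | R a i j}) (i j : ι) :
    MeasurableSet {a | Relation.ReflTransGen (R a) i j} := by
  -- `T n j` is the event that a chain of exactly `n` steps leads from `i` to `j`.
  let T : ℕ → ι → Set α := fun n => n.rec (fun j => {_a | i = j})
    (fun _ S j => ⋃ k, S k ∩ {a | R a k j})
  have hT : ∀ n j, MeasurableSet (T n j) := by
    intro n
    induction n with
    | zero => exact fun j => MeasurableSet.const _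
    | succ n ih => exact fun j => MeasurableSet.iUnion fun k => (ih k).inter (hR k j)
  have : {a | Relation.ReflTransGen (R a) i j} = ⋃ n, T n j := by
    ext a
    simp only [mem_ofPred_eq, mem_iUnion]
    constructor
    · intro h
      induction h with
      | refl => exact ⟨0, rfl⟩
      | tail _ hkj ih =>
        obtain ⟨n, hn⟩ := ih
        exact ⟨n + 1, mem_iUnion.2 ⟨_, hn, hkj⟩⟩
    · rintro ⟨n, hn⟩
      induction n generalizing j with
      | zero => exact (show i = j from hn) ▸ Relation.ReflTransGen.refl
      | succ n ih =>
        obtain ⟨k, hk, hkj⟩ := mem_iUnion.1 hn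
        exact (ih k hk).tail hkj
  rw [this]
  exact MeasurableSet.iUnion fun n => hT n j

namespace BooleanModel

variable {d : ℕ}

/-- The points of the Boolean model: a center and a radius. -/
abbrev Grain (d : ℕ) : Type := EuclideanSpace ℝ (Fin d) × ℝ≥0

/-- Some point of `V` is joined to some point of `W` inside `U` and the occupied set. -/
def Connects (U V W : Set (EuclideanSpace ℝ (Fin d))) (c : Set (Grain d)) : Prop :=
  ∃ a ∈ V, ∃ b ∈ W, JoinedIn (occupied c ∩ U) a b

lemma mem_occupied {c : Set (Grain d)} {x : EuclideanSpace ℝ (Fin d)} :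
    x ∈ occupied c ↔ ∃ p ∈ c, dist x p.1 < p.2 := by
  simp [occupied]

lemma occupied_mono {c c' : Set (Grain d)} (h : c ⊆ c') : occupied c ⊆ occupied c' :=
  biUnion_subset_biUnion_left h

/-- Centers of a countable base of balls. -/
noncomputable def baseCenter (d : ℕ) (i : ℕ × ℕ) : EuclideanSpace ℝ (Fin d) :=
  TopologicalSpace.denseSeq _ i.1

/-- Radii of a countable base of balls. -/
noncomputable def baseRadius (i : ℕ × ℕ) : ℝ := 1 / ((i.2 : ℝ) + 1)

/-- A countable base of balls. -/
noncomputable def baseBall (d : ℕ) (i : ℕ × ℕ) : Set (EuclideanSpace ℝ (Fin d)) :=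
  Metric.ball (baseCenter d i) (baseRadius i)

lemma baseRadius_pos (i : ℕ × ℕ) : 0 < baseRadius i := by unfold baseRadius; positivity

/-- The grains that cover a ball of the base. -/
def covering (d : ℕ) (i : ℕ × ℕ) : Set (Grain d) :=
  {p | dist p.1 (baseCenter d i) + baseRadius i ≤ p.2}

lemma measurableSet_covering (i : ℕ × ℕ) : MeasurableSet (covering d i) := by
  refine IsClosed.measurableSet (isClosed_le ?_ ?_) <;> fun_prop

lemma baseBall_subset_ball {i : ℕ × ℕ} {p : Grain d} (h : p ∈ covering d i) :
    baseBall d i ⊆ Metric.ball p.1 p.2 := by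
  refine Metric.ball_subset_ball' ?_
  rw [dist_comm, add_comm]
  exact h

/-- The base balls inside `U` that are covered by one grain of the configuration. -/
def coveredIn (U : Set (EuclideanSpace ℝ (Fin d))) (c : Set (Grain d)) : Set (ℕ × ℕ) :=
  {i | baseBall d i ⊆ U ∧ ∃ p ∈ c, p ∈ covering d i}

/-- Two covered base balls overlap. -/
def Linked (U : Set (EuclideanSpace ℝ (Fin d))) (c : Set (Grain d)) (i j : ℕ × ℕ) : Prop :=
  i ∈ coveredIn U c ∧ j ∈ coveredIn U c ∧ (baseBall d i ∩ baseBall d j).Nonempty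

lemma baseBall_subset_of_mem_coveredIn {U : Set (EuclideanSpace ℝ (Fin d))} {c : Set (Grain d)}
    {i : ℕ × ℕ} (hi : i ∈ coveredIn U c) : baseBall d i ⊆ occupied c ∩ U := by
  obtain ⟨hU, p, hp, hpi⟩ := hi
  exact subset_inter (fun x hx => mem_occupied.2 ⟨p, hp, baseBall_subset_ball hpi hx⟩) hU

lemma exists_mem_coveredIn {U : Set (EuclideanSpace ℝ (Fin d))} (hU : IsOpen U)
    {c : Set (Grain d)} {x : EuclideanSpace ℝ (Fin d)} (hx : x ∈ occupied c ∩ U) :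
    ∃ i ∈ coveredIn U c, x ∈ baseBall d i := by
  obtain ⟨hxc, hxU⟩ := hx
  obtain ⟨p, hp, hxp⟩ := mem_occupied.1 hxc
  obtain ⟨e, he, hball⟩ := Metric.isOpen_iff.1 hU x hxU
  obtain ⟨n, hn⟩ := exists_nat_one_div_lt
    (show 0 < min e (p.2 - dist x p.1) / 2 from half_pos (lt_min he (sub_pos.2 hxp)))
  obtain ⟨m, hm⟩ := (TopologicalSpace.denseRange_denseSeq
    (EuclideanSpace ℝ (Fin d))).exists_dist_lt x (ε := 1 / ((n : ℝ) + 1)) (by positivity)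
  have h1 := min_le_left e (p.2 - dist x p.1)
  have h2 := min_le_right e (p.2 - dist x p.1)
  have hdist : dist x (baseCenter d (m, n)) < baseRadius (m, n) := hm
  have hrad : baseRadius (m, n) < min e (p.2 - dist x p.1) / 2 := hn
  refine ⟨(m, n), ⟨fun y hy => hball ?_, p, hp, ?_⟩, hdist⟩
  · have hy' : dist y (baseCenter d (m, n)) < baseRadius (m, n) := hy
    rw [Metric.mem_ball]
    linarith [dist_triangle_right y x (baseCenter d (m, n))]
  · change dist p.1 (baseCenter d (m, n)) + baseRadius (m, n) ≤ p.2
    have := dist_triangle p.1 x (baseCenter d (m, n))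
    rw [dist_comm p.1 x] at this
    linarith

/-- Replaces paths by finite chains in a countable family. The covered base balls reachable from `i`
and the unreachable ones have disjoint open unions, and a path, being connected, cannot meet both.
-/
lemma connects_iff_chain {U V W : Set (EuclideanSpace ℝ (Fin d))} (hU : IsOpen U)
    {c : Set (Grain d)} :
    Connects U V W c ↔ ∃ i j : ℕ × ℕ, ((baseBall d i ∩ V).Nonempty ∧ (baseBall d j ∩ W).Nonempty) ∧
      i ∈ coveredIn U c ∧ Relation.ReflTransGen (Linked U c) i j := by
  constructor
  · rintro ⟨a, haV, b, hbW, hab⟩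
    obtain ⟨i, hi, hai⟩ := exists_mem_coveredIn hU hab.source_mem
    let O : Set (EuclideanSpace ℝ (Fin d)) :=
      ⋃ j ∈ {j | j ∈ coveredIn U c ∧ Relation.ReflTransGen (Linked U c) i j}, baseBall d j
    let O' : Set (EuclideanSpace ℝ (Fin d)) :=
      ⋃ j ∈ {j | j ∈ coveredIn U c ∧ ¬ Relation.ReflTransGen (Linked U c) i j}, baseBall d j
    have hO : IsOpen O := isOpen_biUnion fun _ _ => Metric.isOpen_ball
    have hO' : IsOpen O' := isOpen_biUnion fun _ _ => Metric.isOpen_ball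
    have haO : a ∈ O := mem_biUnion (x := i) ⟨hi, Relation.ReflTransGen.refl⟩ hai
    have hbO : b ∈ O := by
      by_contra hbO
      obtain ⟨γ, hγ⟩ := hab
      have hcov : range γ ⊆ O ∪ O' := by
        rintro _ ⟨t, rfl⟩
        obtain ⟨j, hj, hxj⟩ := exists_mem_coveredIn hU (hγ t)
        by_cases hr : Relation.ReflTransGen (Linked U c) i j
        · exact Or.inl (mem_biUnion (x := j) ⟨hj, hr⟩ hxj)
        · exact Or.inr (mem_biUnion (x := j) ⟨hj, hr⟩ hxj)
      have hb : b ∈ range γ := ⟨1, γ.target⟩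
      obtain ⟨x, -, hxO, hxO'⟩ := (isPreconnected_range γ.continuous) O O' hO hO' hcov
        ⟨a, ⟨0, γ.source⟩, haO⟩ ⟨b, hb, (hcov hb).resolve_left hbO⟩
      obtain ⟨j, ⟨hj, hr⟩, hxj⟩ := mem_iUnion₂.1 hxO
      obtain ⟨k, ⟨hk, hr'⟩, hxk⟩ := mem_iUnion₂.1 hxO'
      exact hr' (hr.tail ⟨hj, hk, x, hxj, hxk⟩)
    obtain ⟨j, ⟨-, hr⟩, hbj⟩ := mem_iUnion₂.1 hbO
    exact ⟨i, j, ⟨⟨a, hai, haV⟩, b, hbj, hbW⟩, hi, hr⟩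
  · rintro ⟨i, j, ⟨⟨a, hai, haV⟩, b, hbj, hbW⟩, hi, hr⟩
    refine ⟨a, haV, b, hbW, ?_⟩
    have hball : ∀ k ∈ coveredIn U c, ∀ x ∈ baseBall d k, ∀ y ∈ baseBall d k,
        JoinedIn (occupied c ∩ U) x y := fun k hk x hx y hy =>
      (((convex_ball _ _).isPathConnected ⟨x, hx⟩).joinedIn x hx y hy).mono
        (baseBall_subset_of_mem_coveredIn hk)
    clear hbW
    induction hr generalizing b with
    | refl => exact hball i hi a hai b hbj
    | tail _ hkj ih =>
      obtain ⟨-, hj, x, hxk, hxj⟩ := hkj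
      exact (ih x hxk).trans (hball _ hj x hxj b hbj)

/-- Connections in `U` by means of the grains in `Z` depend only on those grains in `Z` that
meet `U`. -/
lemma measurableSet_connects_localSigma {U V W : Set (EuclideanSpace ℝ (Fin d))} (hU : IsOpen U)
    {Z Z' : Set (Grain d)} (hZ : MeasurableSet Z)
    (hZ' : ∀ p ∈ Z, ∀ u ∈ U, dist u p.1 < p.2 → p ∈ Z') :
    MeasurableSet[localSigma Z']
      {c : Configuration (Grain d) | Connects U V W ((show Set (Grain d) from c) ∩ Z)} := by
  let : MeasurableSpace (Configuration (Grain d)) := localSigma Z'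
  have hcov : ∀ i, MeasurableSet
      {c : Configuration (Grain d) | i ∈ coveredIn U ((show Set (Grain d) from c) ∩ Z)} := by
    intro i
    by_cases hi : baseBall d i ⊆ U
    · have : {c : Configuration (Grain d) | i ∈ coveredIn U ((show Set (Grain d) from c) ∩ Z)}
          = (voidEvent (Z ∩ covering d i))ᶜ := by
        ext c
        rw [mem_compl_voidEvent]
        constructor
        · rintro ⟨-, p, ⟨hp, hpZ⟩, hpi⟩
          exact ⟨p, hp, hpZ, hpi⟩
        · rintro ⟨p, hp, hpZ, hpi⟩
          exact ⟨hi, p, ⟨hp, hpZ⟩, hpi⟩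
      rw [this]
      refine (measurableSet_voidEvent_localSigma (hZ.inter (measurableSet_covering i)) ?_).compl
      rintro p ⟨hpZ, hpi⟩
      have hmem := Metric.mem_ball_self (x := baseCenter d i) (baseRadius_pos i)
      -- The center of the base ball witnesses that the grain meets `U`.
      exact hZ' p hpZ _ (hi hmem) (baseBall_subset_ball hpi hmem)
    · have : {c : Configuration (Grain d) | i ∈ coveredIn U ((show Set (Grain d) from c) ∩ Z)}
          = ∅ := eq_empty_of_forall_notMem fun c hc => hi hc.1
      rw [this]
      exact MeasurableSet.empty
  have hlink : ∀ i j, MeasurableSet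
      {c : Configuration (Grain d) | Linked U ((show Set (Grain d) from c) ∩ Z) i j} :=
    fun i j => (hcov i).inter ((hcov j).inter (MeasurableSet.const _))
  simp_rw [connects_iff_chain hU]
  simp only [ofPred_exists]
  exact MeasurableSet.iUnion fun i => MeasurableSet.iUnion fun j =>
    (MeasurableSet.const _).inter ((hcov i).inter (measurableSet_reflTransGen hlink i j))

lemma measurableSet_connects {U : Set (EuclideanSpace ℝ (Fin d))} (hU : IsOpen U)
    (V W : Set (EuclideanSpace ℝ (Fin d))) :
    MeasurableSet {c : Configuration (Grain d) | Connects U V W c} := by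
  have := measurableSet_connects_localSigma (V := V) (W := W) hU MeasurableSet.univ
    (Z' := univ) (fun _ _ _ _ _ => mem_univ _)
  have heq : ∀ c : Set (Grain d), Connects U V W (c ∩ univ) ↔ Connects U V W c := fun c => by
    rw [inter_univ]
  exact (congrArg _ (Set.ext heq)).mp this

end BooleanModel

/-! ### Invariance of the model under isometries -/

namespace BooleanModel

variable {d : ℕ}

instance sigmaFinite_intensity (lam : ℝ) (ρ : Measure ℝ≥0) [IsProbabilityMeasure ρ] :
    SigmaFinite (intensity d lam ρ) := by
  unfold intensity
  have : SigmaFinite (ENNReal.ofReal lam • (volume : Measure (EuclideanSpace ℝ (Fin d)))) :=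
    inferInstanceAs (SigmaFinite (lam.toNNReal • volume))
  infer_instance

/-- The action on grains of an isometry of the space of centers. -/
noncomputable def grainEquiv
    (T : EuclideanSpace ℝ (Fin d) ≃ᵢ EuclideanSpace ℝ (Fin d)) : Grain d ≃ᵐ Grain d :=
  T.toHomeomorph.toMeasurableEquiv.prodCongr (MeasurableEquiv.refl ℝ≥0)

lemma measurePreserving_grainEquiv
    {T : EuclideanSpace ℝ (Fin d) ≃ᵢ EuclideanSpace ℝ (Fin d)} (hT : MeasurePreserving T)
    (lam : ℝ) (ρ : Measure ℝ≥0) [IsProbabilityMeasure ρ] :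
    MeasurePreserving (grainEquiv T) (intensity d lam ρ) (intensity d lam ρ) :=
  (hT.smul_measure (ENNReal.ofReal lam)).prod (MeasurePreserving.id ρ)

lemma occupied_preimage_grainEquiv
    (T : EuclideanSpace ℝ (Fin d) ≃ᵢ EuclideanSpace ℝ (Fin d)) (c : Set (Grain d)) :
    occupied (grainEquiv T ⁻¹' c) ⊆ T ⁻¹' occupied c := by
  intro x hx
  obtain ⟨p, hp, hxp⟩ := mem_occupied.1 hx
  exact mem_occupied.2 ⟨(T p.1, p.2), hp, by simpa [T.dist_eq] using hxp⟩

lemma connects_of_mapsTo {T : EuclideanSpace ℝ (Fin d) ≃ᵢ EuclideanSpace ℝ (Fin d)}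
    {U V W U' V' W' : Set (EuclideanSpace ℝ (Fin d))} (hU : MapsTo T U U') (hV : MapsTo T V V')
    (hW : MapsTo T W W') {c : Set (Grain d)} (h : Connects U V W (grainEquiv T ⁻¹' c)) :
    Connects U' V' W' c := by
  obtain ⟨a, ha, b, hb, γ, hγ⟩ := h
  refine ⟨T a, hV ha, T b, hW hb, γ.map T.continuous, fun t => ?_⟩
  obtain ⟨h1, h2⟩ := hγ t
  exact ⟨occupied_preimage_grainEquiv T c h1, hU h2⟩

section Law

variable {μ : Measure (Configuration (Grain d))} {lam : ℝ} {ρ : Measure ℝ≥0}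
  [IsProbabilityMeasure ρ]

lemma measure_connects_le_of_mapsTo (h : HasPoissonVoids μ (intensity d lam ρ))
    {T : EuclideanSpace ℝ (Fin d) ≃ᵢ EuclideanSpace ℝ (Fin d)} (hT : MeasurePreserving T)
    {U V W U' V' W' : Set (EuclideanSpace ℝ (Fin d))} (hU : MapsTo T U U') (hV : MapsTo T V V')
    (hW : MapsTo T W W') (hUo : IsOpen U) :
    μ {c | Connects U V W c} ≤ μ {c | Connects U' V' W' c} := by
  rw [← h.measure_preimage_eq (grainEquiv T) (measurePreserving_grainEquiv hT lam ρ)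
    (measurableSet_connects hUo V W)]
  exact measure_mono fun c hc => connects_of_mapsTo hU hV hW hc

end Law

/-! ### Arm events and the renormalisation step -/

/-- The configurations in which the ball `B(z, m)` is connected inside `B(z, 3m)` to the outside of
`B(z, 2m)`. -/
def Arm (z : EuclideanSpace ℝ (Fin d)) (m : ℝ) (c : Set (Grain d)) : Prop :=
  Connects (Metric.ball z (3 * m)) (Metric.ball z m) (Metric.closedBall z (2 * m))ᶜ c

lemma measurableSet_arm (z : EuclideanSpace ℝ (Fin d)) (m : ℝ) :
    MeasurableSet {c : Configuration (Grain d) | Arm z m c} :=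
  measurableSet_connects Metric.isOpen_ball _ _

/-- The path is stopped at distance `5 / 2 * m`, strictly between the radii `2 * m` and `3 * m`. -/
lemma arm_of_joinedIn {z a b : EuclideanSpace ℝ (Fin d)} {m : ℝ} {c : Set (Grain d)} {F : Set _}
    (hm : 0 < m) (h : JoinedIn F a b) (hF : F ∩ Metric.ball z (3 * m) ⊆ occupied c)
    (ha : dist a z < m) (hb : 3 * m ≤ dist b z) : Arm z m c := by
  obtain ⟨p, hp, hj⟩ := h.exists_eq_of_le_of_le (f := fun x => dist x z) (by fun_prop)
    (s := 5 / 2 * m) (by linarith) (by linarith)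
  refine ⟨a, ha, p, ?_, hj.mono ?_⟩
  · simp only [mem_compl_iff, Metric.mem_closedBall, not_le]
    linarith
  · rintro x ⟨hxF, hx⟩
    have hx' : x ∈ Metric.ball z (3 * m) := by
      rw [Metric.mem_ball]
      have : dist x z ≤ 5 / 2 * m := hx
      linarith
    exact ⟨hF ⟨hxF, hx'⟩, hx'⟩

/-- The grains with radius at least `m` and center within `a` times the radius of the origin. -/
def nearGrains (d : ℕ) (a m : ℝ) : Set (Grain d) := {p | m ≤ p.2 ∧ dist p.1 0 < a * p.2}

/-- The grains with radius less than `m`. -/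
def smallGrains (d : ℕ) (m : ℝ) : Set (Grain d) := {p | (p.2 : ℝ) < m}

lemma measurableSet_nearGrains (a m : ℝ) : MeasurableSet (nearGrains d a m) := by
  have h1 : MeasurableSet {p : Grain d | m ≤ p.2} := measurableSet_le (by fun_prop) (by fun_prop)
  have h2 : MeasurableSet {p : Grain d | dist p.1 0 < a * p.2} :=
    measurableSet_lt (by fun_prop) (by fun_prop)
  exact h1.inter h2

lemma measurableSet_smallGrains (m : ℝ) : MeasurableSet (smallGrains d m) := by
  refine measurableSet_lt ?_ ?_ <;> fun_prop

/-- For each radius `r ≥ m` the admissible centers fill a ball of radius `a * r`, whose volume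
scales by `a ^ d` whatever `r` is. -/
lemma intensity_nearGrains (lam : ℝ) (ρ : Measure ℝ≥0) [IsProbabilityMeasure ρ] {a : ℝ}
    (ha : 0 < a) (m : ℝ) : intensity d lam ρ (nearGrains d a m)
      = ENNReal.ofReal (a ^ d) * intensity d lam ρ (nearGrains d 1 m) := by
  have hsig : SFinite (ENNReal.ofReal lam • (volume : Measure (EuclideanSpace ℝ (Fin d)))) :=
    inferInstance
  unfold intensity
  rw [Measure.prod_apply_symm (measurableSet_nearGrains a m),
    Measure.prod_apply_symm (measurableSet_nearGrains 1 m),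
    ← lintegral_const_mul' _ _ ENNReal.ofReal_ne_top]
  refine lintegral_congr fun r => ?_
  simp only [Measure.smul_apply, smul_eq_mul]
  have hslice : ∀ b : ℝ, (fun x : EuclideanSpace ℝ (Fin d) => (x, r)) ⁻¹' nearGrains d b m
      = {_x | m ≤ r} ∩ Metric.ball 0 (b * r) := fun b => rfl
  rw [hslice, hslice]
  by_cases hr : m ≤ r
  · have huniv : {_x : EuclideanSpace ℝ (Fin d) | m ≤ r} = univ := by simp [hr]
    rw [huniv, univ_inter, univ_inter, Measure.addHaar_ball_mul_of_pos _ _ ha, one_mul,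
      finrank_euclideanSpace_fin]
    ring
  · have hempty : {_x : EuclideanSpace ℝ (Fin d) | m ≤ r} = ∅ := by simp [hr]
    simp [hempty]

lemma exists_net_sphere (d : ℕ) : ∃ T : Finset (EuclideanSpace ℝ (Fin d)), (∀ t ∈ T, ‖t‖ = 1) ∧
    ∀ (s : ℝ), 0 < s → ∀ x : EuclideanSpace ℝ (Fin d), ‖x‖ = s →
      ∃ t ∈ T, dist x (s • t) < s / 20 := by
  obtain ⟨T, hT, hfin, hcov⟩ := (isCompact_sphere (0 : EuclideanSpace ℝ (Fin d))
    1).finite_cover_balls (show (0 : ℝ) < 1 / 20 by norm_num)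
  refine ⟨hfin.toFinset, fun t ht => by simpa using hT (hfin.mem_toFinset.1 ht), ?_⟩
  intro s hs x hx
  have hmem : s⁻¹ • x ∈ Metric.sphere (0 : EuclideanSpace ℝ (Fin d)) 1 := by
    simp [norm_smul, hx, abs_of_pos hs, hs.ne']
  obtain ⟨t, ht, hxt⟩ := mem_iUnion₂.1 (hcov hmem)
  refine ⟨t, hfin.mem_toFinset.2 ht, ?_⟩
  have : x = s • s⁻¹ • x := by rw [smul_smul, mul_inv_cancel₀ hs.ne', one_smul]
  rw [this, dist_smul₀, Real.norm_of_nonneg hs.le]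
  have h1 : dist (s⁻¹ • x) t < 1 / 20 := hxt
  nlinarith

/-- The long arm passes through points `p`, `q` at distances `10 * m` and `20 * m` from the origin.
Each lies within `m` of a net point, and the path between them is long enough to be an arm around
both net points. -/
lemma exists_arms_of_arm {m : ℝ} (hm : 0 < m) {c : Set (Grain d)}
    (hc : Disjoint c (nearGrains d 31 m)) {T : Finset (EuclideanSpace ℝ (Fin d))}
    (hT1 : ∀ t ∈ T, ‖t‖ = 1)
    (hT : ∀ (s : ℝ), 0 < s → ∀ x : EuclideanSpace ℝ (Fin d), ‖x‖ = s →
      ∃ t ∈ T, dist x (s • t) < s / 20) (harm : Arm 0 (10 * m) c) :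
    ∃ t₁ ∈ T, ∃ t₂ ∈ T, Arm ((10 * m) • t₁) m (c ∩ smallGrains d m) ∧
      Arm ((20 * m) • t₂) m (c ∩ smallGrains d m) := by
  obtain ⟨a, ha, b, hb, hab⟩ := harm
  set F := occupied c ∩ Metric.ball (0 : EuclideanSpace ℝ (Fin d)) (3 * (10 * m))
  have hF : F ⊆ occupied (c ∩ smallGrains d m) := by
    rintro x ⟨hxc, hx⟩
    obtain ⟨p, hp, hxp⟩ := mem_occupied.1 hxc
    refine mem_occupied.2 ⟨p, ⟨hp, ?_⟩, hxp⟩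
    change (p.2 : ℝ) < m
    by_contra! hmp
    -- A grain of radius r ≥ m meeting `B(0, 30m)` has its center within 30m + r ≤ 31r of the
    -- origin.
    refine disjoint_left.1 hc hp ⟨hmp, ?_⟩
    rw [Metric.mem_ball] at hx
    have := dist_triangle_left p.1 0 x
    linarith
  have ha' : dist a 0 < 10 * m := ha
  have hb' : 2 * (10 * m) < dist b 0 := by simpa using hb
  obtain ⟨p, hp, hjp⟩ := hab.exists_eq_of_le_of_le (f := fun x => dist x 0) (by fun_prop)
    (s := 10 * m) (by linarith) (by linarith)
  obtain ⟨q, hq, hjq⟩ := hab.exists_eq_of_le_of_le (f := fun x => dist x 0) (by fun_prop)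
    (s := 20 * m) (by linarith) (by linarith)
  have hpq : JoinedIn F p q := (hjp.mono inter_subset_left).symm.trans (hjq.mono inter_subset_left)
  obtain ⟨t₁, ht₁, h1⟩ := hT (10 * m) (by linarith) p (by simpa using hp)
  obtain ⟨t₂, ht₂, h2⟩ := hT (20 * m) (by linarith) q (by simpa using hq)
  have hz1 : dist ((10 * m) • t₁) 0 = 10 * m := by
    rw [dist_zero_right, norm_smul, hT1 t₁ ht₁, Real.norm_of_nonneg (by linarith), mul_one]
  have hz2 : dist ((20 * m) • t₂) 0 = 20 * m := by
    rw [dist_zero_right, norm_smul, hT1 t₂ ht₂, Real.norm_of_nonneg (by linarith), mul_one]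
  refine ⟨t₁, ht₁, t₂, ht₂, ?_, ?_⟩
  · refine arm_of_joinedIn hm hpq (inter_subset_left.trans hF) (by linarith) ?_
    have := dist_triangle q ((10 * m) • t₁) 0
    linarith
  · refine arm_of_joinedIn hm hpq.symm (inter_subset_left.trans hF) (by linarith) ?_
    have := dist_triangle ((20 * m) • t₂) p 0
    rw [dist_comm _ p] at this
    linarith

section Law

variable {μ : Measure (Configuration (Grain d))} {lam : ℝ} {ρ : Measure ℝ≥0}
  [IsProbabilityMeasure ρ]

lemma measure_arm_le (h : HasPoissonVoids μ (intensity d lam ρ)) (z : EuclideanSpace ℝ (Fin d))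
    (m : ℝ) : μ {c | Arm z m c} ≤ μ {c | Arm 0 m c} := by
  have hdist : ∀ x, dist (IsometryEquiv.addRight (-z) x) 0 = dist x z := fun x => by
    simp [dist_eq_norm, sub_eq_add_neg]
  refine measure_connects_le_of_mapsTo h (T := IsometryEquiv.addRight (-z))
    (measurePreserving_add_right _ _) ?_ ?_ ?_ Metric.isOpen_ball
  · intro x hx
    rwa [Metric.mem_ball, hdist]
  · intro x hx
    rwa [Metric.mem_ball, hdist]
  · intro x hx
    rwa [mem_compl_iff, Metric.mem_closedBall, hdist]

lemma connects_mono {U V W : Set (EuclideanSpace ℝ (Fin d))} {c c' : Set (Grain d)} (h : c ⊆ c')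
    (hc : Connects U V W c) : Connects U V W c' := by
  obtain ⟨a, ha, b, hb, hab⟩ := hc
  exact ⟨a, ha, b, hb, hab.mono (inter_subset_inter_left _ (occupied_mono h))⟩

/-- Grains of radius below `m` that meet `B(z, 3m)` have centers in `B(z, 4m)`; the separation `8 *
m` makes these balls disjoint. -/
lemma measure_two_arms_le (h : HasPoissonVoids μ (intensity d lam ρ)) {m : ℝ}
    {z₁ z₂ : EuclideanSpace ℝ (Fin d)} (hz : 8 * m ≤ dist z₁ z₂) :
    μ ({c | Arm z₁ m ((show Set (Grain d) from c) ∩ smallGrains d m)} ∩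
      {c | Arm z₂ m ((show Set (Grain d) from c) ∩ smallGrains d m)}) ≤
      μ {c | Arm 0 m c} ^ 2 := by
  have hmeas : ∀ z : EuclideanSpace ℝ (Fin d), MeasurableSet[localSigma
      {p : Grain d | dist p.1 z < 4 * m}] {c : Configuration (Grain d) |
        Arm z m ((show Set (Grain d) from c) ∩ smallGrains d m)} := fun z => by
    refine measurableSet_connects_localSigma Metric.isOpen_ball (measurableSet_smallGrains m) ?_
    intro p hp u hu hup
    rw [Metric.mem_ball] at hu
    have hp' : (p.2 : ℝ) < m := hp
    change dist p.1 z < 4 * m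
    have := dist_triangle_left p.1 z u
    linarith
  have hdisj : Disjoint {p : Grain d | dist p.1 z₁ < 4 * m} {p : Grain d | dist p.1 z₂ < 4 * m} := by
    rw [disjoint_left]
    intro p h1 h2
    have h1' : dist p.1 z₁ < 4 * m := h1
    have h2' : dist p.1 z₂ < 4 * m := h2
    have := dist_triangle_left z₁ z₂ p.1
    linarith
  rw [(Indep_iff _ _ _).1 (h.indep hdisj) _ _ (hmeas z₁) (hmeas z₂), sq]
  have hle : ∀ z : EuclideanSpace ℝ (Fin d),
      μ {c | Arm z m ((show Set (Grain d) from c) ∩ smallGrains d m)} ≤ μ {c | Arm 0 m c} :=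
    fun z => (measure_mono fun c hc => connects_mono inter_subset_left hc).trans
      (measure_arm_le h z m)
  exact mul_le_mul' (hle z₁) (hle z₂)

lemma measure_arm_step (h : HasPoissonVoids μ (intensity d lam ρ)) {m : ℝ} (hm : 0 < m)
    {T : Finset (EuclideanSpace ℝ (Fin d))} (hT1 : ∀ t ∈ T, ‖t‖ = 1)
    (hT : ∀ (s : ℝ), 0 < s → ∀ x : EuclideanSpace ℝ (Fin d), ‖x‖ = s →
      ∃ t ∈ T, dist x (s • t) < s / 20) :
    μ {c | Arm 0 (10 * m) c} ≤ intensity d lam ρ (nearGrains d 31 m)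
      + (T.card : ℝ≥0∞) ^ 2 * μ {c | Arm 0 m c} ^ 2 := by
  let E : EuclideanSpace ℝ (Fin d) → Set (Configuration (Grain d)) :=
    fun z => {c | Arm z m ((show Set (Grain d) from c) ∩ smallGrains d m)}
  have hsub : {c : Configuration (Grain d) | Arm 0 (10 * m) c} ⊆
      (voidEvent (nearGrains d 31 m))ᶜ ∪
        ⋃ t₁ ∈ T, ⋃ t₂ ∈ T, E ((10 * m) • t₁) ∩ E ((20 * m) • t₂) := by
    intro c hc
    by_cases hv : c ∈ voidEvent (nearGrains d 31 m)
    · obtain ⟨t₁, ht₁, t₂, ht₂, h1, h2⟩ := exists_arms_of_arm hm hv hT1 hT hc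
      exact Or.inr (mem_biUnion (x := t₁) ht₁ (mem_biUnion (x := t₂) ht₂ ⟨h1, h2⟩))
    · exact Or.inl hv
  refine (measure_mono hsub).trans ((measure_union_le _ _).trans (add_le_add
    (h.apply_compl_voidEvent_le (measurableSet_nearGrains 31 m)) ?_))
  calc μ (⋃ t₁ ∈ T, ⋃ t₂ ∈ T, E ((10 * m) • t₁) ∩ E ((20 * m) • t₂))
      ≤ ∑ t₁ ∈ T, ∑ t₂ ∈ T, μ (E ((10 * m) • t₁) ∩ E ((20 * m) • t₂)) :=
        (measure_biUnion_finset_le _ _).trans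
          (Finset.sum_le_sum fun _ _ => measure_biUnion_finset_le _ _)
    _ ≤ ∑ _t₁ ∈ T, ∑ _t₂ ∈ T, μ {c | Arm 0 m c} ^ 2 := by
        refine Finset.sum_le_sum fun t₁ ht₁ => Finset.sum_le_sum fun t₂ ht₂ =>
          measure_two_arms_le h ?_
        have h1 : dist ((10 * m) • t₁) 0 = 10 * m := by
          rw [dist_zero_right, norm_smul, hT1 t₁ ht₁, Real.norm_of_nonneg (by linarith), mul_one]
        have h2 : dist ((20 * m) • t₂) 0 = 20 * m := by
          rw [dist_zero_right, norm_smul, hT1 t₂ ht₂, Real.norm_of_nonneg (by linarith), mul_one]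
        have := dist_triangle_left ((20 * m) • t₂) 0 ((10 * m) • t₁)
        linarith
    _ = _ := by
        simp only [Finset.sum_const, nsmul_eq_mul]
        ring

end Law

end BooleanModel

/-! ### Auxiliary geometry and recursive inequalities -/

lemma EuclideanSpace.norm_le_card_mul {d : ℕ} [NeZero d] {x : EuclideanSpace ℝ (Fin d)} {B : ℝ}
    (hB : 0 ≤ B) (h : ∀ i, |x i| ≤ B) : ‖x‖ ≤ d * B := by
  have hd : (1 : ℝ) ≤ d := by exact_mod_cast NeZero.one_le
  rw [EuclideanSpace.norm_eq, Real.sqrt_le_left (by positivity)]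
  calc ∑ i, ‖x i‖ ^ 2 ≤ ∑ _i : Fin d, B ^ 2 :=
        Finset.sum_le_sum fun i _ => pow_le_pow_left₀ (norm_nonneg _) (h i) 2
    _ = d * B ^ 2 := by simp
    _ ≤ (d * B) ^ 2 := by nlinarith [sq_nonneg B, mul_nonneg (sub_nonneg.2 hd) (sq_nonneg B)]

lemma exists_signed_swap_isometry {d : ℕ} (i j : Fin d) {σ : ℝ}
    (hσ : σ = 1 ∨ σ = -1) :
    ∃ L : EuclideanSpace ℝ (Fin d) ≃ₗᵢ[ℝ] EuclideanSpace ℝ (Fin d),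
      ∀ x k, L x k = σ * x (Equiv.swap i j k) := by
  let S := LinearIsometryEquiv.piLpCongrLeft 2 ℝ ℝ (Equiv.swap i j)
  have hS : ∀ (x : EuclideanSpace ℝ (Fin d)) k, S x k = x (Equiv.swap i j k) := fun x k => by
    simp [S, LinearIsometryEquiv.piLpCongrLeft_apply]
  rcases hσ with rfl | rfl
  · exact ⟨S, fun x k => by rw [hS, one_mul]⟩
  · exact ⟨S.trans (LinearIsometryEquiv.neg ℝ), fun x k => by
      simp only [LinearIsometryEquiv.trans_apply, LinearIsometryEquiv.coe_neg, PiLp.neg_apply, hS]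
      ring⟩

lemma tendsto_zero_of_le_half_add {x g : ℕ → ℝ} {δ : ℝ} (hx0 : ∀ n, 0 ≤ x n) (hxδ : ∀ n, x n ≤ δ)
    (hx : ∀ n, x (n + 1) ≤ x n / 2 + g n) (hg : Tendsto g atTop (𝓝 0)) :
    Tendsto x atTop (𝓝 0) := by
  have hδ : 0 ≤ δ := (hx0 0).trans (hxδ 0)
  -- Each round halves the eventual bound and loses a quarter of it to `g`; `δ + 1` keeps the bound
  -- positive.
  have key : ∀ k : ℕ, ∀ᶠ n in atTop, x n ≤ (3 / 4 : ℝ) ^ k * (δ + 1) := by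
    intro k
    induction k with
    | zero => exact Eventually.of_forall fun n => by linarith [hxδ n]
    | succ k ih =>
      have hpos : 0 < (3 / 4 : ℝ) ^ k * (δ + 1) / 4 := by positivity
      have hsucc : ∀ᶠ n in atTop, x (n + 1) ≤ (3 / 4 : ℝ) ^ (k + 1) * (δ + 1) := by
        filter_upwards [ih, hg.eventually (gt_mem_nhds hpos)] with n h1 h2
        rw [pow_succ]
        linarith [hx n]
      rw [← map_add_atTop_eq_nat 1, eventually_map]
      exact hsucc
  have hlim : Tendsto (fun k : ℕ => (3 / 4 : ℝ) ^ k * (δ + 1)) atTop (𝓝 0) := by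
    simpa using (tendsto_pow_atTop_nhds_zero_of_lt_one (r := (3 / 4 : ℝ)) (by norm_num)
      (by norm_num)).mul_const (δ + 1)
  refine (tendsto_order.2 ⟨fun a ha => Eventually.of_forall fun n => ha.trans_le (hx0 n), ?_⟩)
  intro a ha
  obtain ⟨k, hk⟩ := (hlim.eventually (gt_mem_nhds ha)).exists
  exact (key k).mono fun n hn => hn.trans_lt hk

/-- Below `δ` the quadratic term is at most half of `x n`, so the bound `δ` propagates and the
recursion becomes a contraction with vanishing error. -/
lemma tendsto_zero_of_quadratic_recursion {x g : ℕ → ℝ} {δ K : ℝ} (hK : 0 ≤ K)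
    (hKδ : K * δ ≤ 1 / 2) (hx0 : ∀ n, 0 ≤ x n) (hxδ : x 0 ≤ δ) (hgδ : ∀ n, g n ≤ δ / 2)
    (hx : ∀ n, x (n + 1) ≤ g n + K * x n ^ 2) (hg : Tendsto g atTop (𝓝 0)) :
    Tendsto x atTop (𝓝 0) := by
  have hhalf : ∀ n, x n ≤ δ → K * x n ^ 2 ≤ x n / 2 := fun n hn => by
    have h1 : K * x n ≤ 1 / 2 := (mul_le_mul_of_nonneg_left hn hK).trans hKδ
    nlinarith [mul_le_mul_of_nonneg_right h1 (hx0 n)]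
  have hle : ∀ n, x n ≤ δ := by
    intro n
    induction n with
    | zero => exact hxδ
    | succ n ih => linarith [hx n, hhalf n ih, hgδ n]
  exact tendsto_zero_of_le_half_add hx0 hle (fun n => by linarith [hx n, hhalf n (hle n)]) hg

/-! ### The initial scale: from box crossings to arms and large grains -/

namespace BooleanModel

variable {d : ℕ}

/-- The open tube with side length `3 * N` around the axis through `z` in direction `j`. -/
def tube (z : EuclideanSpace ℝ (Fin d)) (j : Fin d) (N : ℝ) : Set (EuclideanSpace ℝ (Fin d)) :=
  {x | ∀ i, i ≠ j → |x i - z i| < 3 / 2 * N}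

lemma isOpen_tube (z : EuclideanSpace ℝ (Fin d)) (j : Fin d) (N : ℝ) : IsOpen (tube z j N) := by
  simp only [tube, ofPred_forall]
  exact isOpen_iInter_of_finite fun i => isOpen_iInter_of_finite fun _ =>
    isOpen_lt (by fun_prop) continuous_const

/-- A connection in a tube across a distance `N`, in direction `σ` along the `j`-th axis. -/
def TubeCross (z : EuclideanSpace ℝ (Fin d)) (j : Fin d) (σ N : ℝ) (c : Set (Grain d)) : Prop :=
  Connects (tube z j N) {x | σ * (x j - z j) < 1 / 4 * N} {x | 5 / 4 * N < σ * (x j - z j)} c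

/-- A connection in the interior of the tube over the box of side lengths `(N, 3N, …, 3N)`, from
one side of the box to the other. -/
def BoxConnects [NeZero d] (N : ℕ) (c : Set (Grain d)) : Prop :=
  Connects {x | ∀ i, i ≠ 0 → 0 < x i ∧ x i < 3 * (N : ℝ)} {x | x 0 < 0} {x | (N : ℝ) < x 0} c

lemma measurableSet_boxConnects [NeZero d] (N : ℕ) :
    MeasurableSet {c : Configuration (Grain d) | BoxConnects N c} := by
  refine measurableSet_connects ?_ _ _
  have hcont : ∀ i, Continuous fun x : EuclideanSpace ℝ (Fin d) => x i := fun i => by fun_prop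
  simp only [ofPred_forall]
  refine isOpen_iInter_of_finite fun i => isOpen_iInter_of_finite fun _ => ?_
  exact (isOpen_lt continuous_const (hcont i)).inter (isOpen_lt (hcont i) continuous_const)

lemma cross_of_boxConnects [NeZero d] {N : ℕ} {c : Set (Grain d)} (h : BoxConnects N c) :
    Cross (occupied c) (sides d N) := by
  obtain ⟨a, ha, b, hb, hab⟩ := h
  obtain ⟨p, q, hp, hq, γ, hγ⟩ := hab.exists_crossing (f := fun x => x 0) (by fun_prop)
    (le_of_lt ha) (Nat.cast_nonneg N) (le_of_lt hb)
  have : PathConnectedSpace unitInterval := isPathConnected_iff_pathConnectedSpace.1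
    ((convex_Icc (0 : ℝ) 1).isPathConnected ⟨0, left_mem_Icc.2 zero_le_one⟩)
  refine ⟨range γ, ?_, ?_, isPathConnected_range γ.continuous, ⟨p, ⟨0, γ.source⟩, hp⟩,
    ⟨q, ⟨1, γ.target⟩, ?_⟩⟩
  · rintro _ ⟨t, rfl⟩
    exact (hγ t).1.1
  · rintro _ ⟨t, rfl⟩ i
    obtain ⟨⟨-, h1⟩, h2⟩ := hγ t
    by_cases hi : i = 0
    · subst hi
      simpa [sides] using h2
    · simpa [sides, hi] using ⟨(h1 i hi).1.le, (h1 i hi).2.le⟩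
  · simpa [sides] using hq

/-- The box lies within distance `3 * d * N` of the origin, at most half the radius of the grain, so
this single grain covers the box. -/
lemma cross_of_mem_nearGrains [NeZero d] {N : ℕ} (hN : 1 ≤ N) {c : Set (Grain d)} {p : Grain d}
    (hp : p ∈ c) (hpN : p ∈ nearGrains d (1 / 2) (6 * d * N)) :
    Cross (occupied c) (sides d N) := by
  have hsides : ∀ i, 0 ≤ sides d N i ∧ sides d N i ≤ 3 * N := fun i => by
    unfold sides
    split_ifs <;> constructor <;> linarith [Nat.cast_nonneg (α := ℝ) N]
  refine ⟨box (sides d N), ?_, subset_rfl, ?_, ?_, ?_⟩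
  · intro x hx
    refine mem_occupied.2 ⟨p, hp, ?_⟩
    have hx' : ‖x‖ ≤ d * (3 * N) := EuclideanSpace.norm_le_card_mul (by positivity) fun i => by
      rw [abs_of_nonneg (hx i).1]
      exact (hx i).2.trans (hsides i).2
    have h1 : (6 * d * N : ℝ) ≤ p.2 := hpN.1
    have h2 : dist p.1 0 < 1 / 2 * p.2 := hpN.2
    have := dist_triangle_right x p.1 0
    rw [dist_zero_right x] at this
    linarith
  · refine Convex.isPathConnected ?_ ⟨0, fun i => ⟨le_rfl, (hsides i).1⟩⟩
    intro x hx y hy s t hs ht hst i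
    simp only [PiLp.add_apply, PiLp.smul_apply, smul_eq_mul]
    have h1 := hx i
    have h2 := hy i
    constructor
    · have := h1.1
      have := h2.1
      positivity
    · nlinarith [mul_le_mul_of_nonneg_left h1.2 hs, mul_le_mul_of_nonneg_left h2.2 ht]
  · exact ⟨0, fun i => ⟨le_rfl, (hsides i).1⟩, rfl⟩
  · exact ⟨WithLp.toLp 2 (sides d N), fun i => ⟨(hsides i).1, le_rfl⟩, rfl⟩

/-- The path is stopped when its sup-distance to `z` reaches `11 / 8 * N`: a coordinate realising it
exceeds `5 / 4 * N`, while all coordinates have stayed below `3 / 2 * N`, inside the tube. -/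
lemma exists_tubeCross_of_joinedIn {z a b : EuclideanSpace ℝ (Fin d)} {N : ℝ} (hN : 0 < N)
    {c : Set (Grain d)} (h : JoinedIn (occupied c) a b) (ha : dist a z < N / 4) {j : Fin d}
    (hb : 3 / 2 * N ≤ |b j - z j|) :
    ∃ j, ∃ σ ∈ ({1, -1} : Finset ℝ), TubeCross z j σ N c := by
  have ha' : ∀ i, |a i - z i| < N / 4 := fun i => by
    rw [dist_eq_norm] at ha
    exact (PiLp.norm_apply_le (a - z) i).trans_lt ha
  let f : EuclideanSpace ℝ (Fin d) → ℝ := fun x => ‖(fun i => x i - z i : Fin d → ℝ)‖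
  have hf : Continuous f := by
    refine Continuous.norm (continuous_pi fun i => ?_)
    fun_prop
  obtain ⟨p, hp, hj⟩ := h.exists_eq_of_le_of_le hf (s := 11 / 8 * N)
    ((pi_norm_le_iff_of_nonneg (by linarith)).2 fun i => (ha' i).le.trans (by linarith))
    (by
      have : |b j - z j| ≤ f b := norm_le_pi_norm (fun i => b i - z i : Fin d → ℝ) j
      linarith)
  obtain ⟨k, hk⟩ : ∃ k, 5 / 4 * N < |p k - z k| := by
    by_contra! hall
    have : f p ≤ 5 / 4 * N := (pi_norm_le_iff_of_nonneg (by linarith)).2 hall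
    linarith
  have hj' : JoinedIn (occupied c ∩ tube z k N) a p := by
    refine hj.mono fun x hx => ⟨hx.1, fun i _ => ?_⟩
    have h1 : |x i - z i| ≤ f x := norm_le_pi_norm (fun i => x i - z i : Fin d → ℝ) i
    have h2 : f x ≤ 11 / 8 * N := hx.2
    linarith
  have hak := abs_lt.1 (ha' k)
  rcases lt_abs.1 hk with hk | hk
  · exact ⟨k, 1, by simp, a, by simp only [mem_ofPred_eq]; linarith, p,
      by simp only [mem_ofPred_eq]; linarith, hj'⟩
  · exact ⟨k, -1, by simp, a, by simp only [mem_ofPred_eq]; linarith, p,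
      by simp only [mem_ofPred_eq]; linarith, hj'⟩

section Law

variable {μ : Measure (Configuration (Grain d))} {lam : ℝ} {ρ : Measure ℝ≥0}
  [IsProbabilityMeasure ρ]

lemma measure_tubeCross_le [NeZero d] (h : HasPoissonVoids μ (intensity d lam ρ))
    (z : EuclideanSpace ℝ (Fin d)) (j : Fin d) {σ : ℝ} (hσ : σ = 1 ∨ σ = -1) (N : ℕ) :
    μ {c | TubeCross z j σ N c} ≤ μ {c | BoxConnects N c} := by
  obtain ⟨L, hL⟩ := exists_signed_swap_isometry 0 j hσ
  -- The shift sends the thresholds `N / 4` and `5 * N / 4` to `0` and `N`, and the transverse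
  -- interval to `(0, 3N)`.
  let v : EuclideanSpace ℝ (Fin d) :=
    WithLp.toLp 2 fun i => if i = 0 then -(1 / 4 * (N : ℝ)) else 3 / 2 * (N : ℝ)
  let T : EuclideanSpace ℝ (Fin d) ≃ᵢ EuclideanSpace ℝ (Fin d) :=
    (IsometryEquiv.addRight (-z)).trans (L.toIsometryEquiv.trans (IsometryEquiv.addRight v))
  have hT : MeasurePreserving T :=
    (measurePreserving_add_right volume v).comp
      (L.measurePreserving.comp (measurePreserving_add_right volume (-z)))
  have hTi : ∀ x i, T x i = σ * (x (Equiv.swap 0 j i) - z (Equiv.swap 0 j i)) + v i := by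
    intro x i
    change (L (x + -z) + v) i = _
    rw [PiLp.add_apply, hL, PiLp.add_apply, PiLp.neg_apply, sub_eq_add_neg]
  have hT0 : ∀ x, T x 0 = σ * (x j - z j) - 1 / 4 * N := fun x => by
    rw [hTi, Equiv.swap_apply_left]
    simp [v, sub_eq_add_neg]
  refine measure_connects_le_of_mapsTo h hT ?_ ?_ ?_ (isOpen_tube z j N)
  · intro x hx i hi
    have hne : Equiv.swap 0 j i ≠ j := fun he => hi (by
      rw [← Equiv.swap_apply_left 0 j] at he
      exact (Equiv.swap 0 j).injective he)
    have h1 := abs_lt.1 (hx _ hne)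
    have h2 : v i = 3 / 2 * (N : ℝ) := by simp [v, hi]
    rw [hTi, h2]
    rcases hσ with rfl | rfl <;> constructor <;> linarith
  · intro x hx
    have : σ * (x j - z j) < 1 / 4 * N := hx
    simp only [mem_ofPred_eq, hT0]
    linarith
  · intro x hx
    have : 5 / 4 * N < σ * (x j - z j) := hx
    simp only [mem_ofPred_eq, hT0]
    linarith

/-- A net of the unit ball of mesh `1 / (24 * d)`, scaled by `6 * d * N`, has mesh `N / 4`, so its
size does not depend on `N`. The arm starts near a net point and ends so far from it that some
coordinate differs by at least `3 / 2 * N`. -/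
lemma exists_measure_arm_le_card_mul (d : ℕ) [NeZero d] : ∃ L : ℕ,
    ∀ (μ : Measure (Configuration (Grain d))) (lam : ℝ) (ρ : Measure ℝ≥0) [IsProbabilityMeasure ρ],
      HasPoissonVoids μ (intensity d lam ρ) → ∀ N : ℕ, 1 ≤ N →
        μ {c | Arm 0 (6 * d * N) c} ≤ L * μ {c | BoxConnects N c} := by
  have hd : (1 : ℝ) ≤ d := by exact_mod_cast NeZero.one_le
  obtain ⟨T, hT, hfin, hcov⟩ := (isCompact_closedBall (0 : EuclideanSpace ℝ (Fin d))
    1).finite_cover_balls (show (0 : ℝ) < 1 / (24 * d) by positivity)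
  refine ⟨hfin.toFinset.card * (d * 2), fun μ lam ρ _ h N hN => ?_⟩
  have hN' : (1 : ℝ) ≤ N := by exact_mod_cast hN
  have hM : (0 : ℝ) < 6 * d * N := by positivity
  have hsub : {c : Configuration (Grain d) | Arm 0 (6 * d * N) c} ⊆
      ⋃ t ∈ hfin.toFinset, ⋃ j ∈ (Finset.univ : Finset (Fin d)), ⋃ σ ∈ ({1, -1} : Finset ℝ),
        {c : Configuration (Grain d) | TubeCross ((6 * d * N : ℝ) • t) j σ N c} := by
    rintro c ⟨a, ha, b, hb, hab⟩
    have ha' : ‖a‖ < 6 * d * N := by simpa using ha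
    have hb' : 2 * (6 * d * N) < ‖b‖ := by simpa using hb
    have hmem : (6 * d * N : ℝ)⁻¹ • a ∈ Metric.closedBall (0 : EuclideanSpace ℝ (Fin d)) 1 := by
      rw [mem_closedBall_zero_iff, norm_smul, Real.norm_of_nonneg (by positivity),
        inv_mul_le_iff₀ hM]
      linarith
    obtain ⟨t, ht, hat⟩ := mem_iUnion₂.1 (hcov hmem)
    have hnear : dist a ((6 * d * N : ℝ) • t) < (N : ℝ) / 4 := by
      have haeq : a = (6 * d * N : ℝ) • (6 * d * N : ℝ)⁻¹ • a := by
        rw [smul_smul, mul_inv_cancel₀ hM.ne', one_smul]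
      rw [haeq, dist_smul₀, Real.norm_of_nonneg hM.le]
      calc _ < (6 * d * N : ℝ) * (1 / (24 * d)) := mul_lt_mul_of_pos_left hat hM
        _ = N / 4 := by field_simp; norm_num
    have hfar : ∃ j, 3 / 2 * (N : ℝ) ≤ |b j - ((6 * d * N : ℝ) • t) j| := by
      by_contra! hall
      have h1 : ‖b - (6 * d * N : ℝ) • t‖ ≤ d * (3 / 2 * N) :=
        EuclideanSpace.norm_le_card_mul (by positivity) fun i => (hall i).le
      have h2 : ‖(6 * d * N : ℝ) • t‖ ≤ 6 * d * N := by
        rw [norm_smul, Real.norm_of_nonneg hM.le]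
        have := mem_closedBall_zero_iff.1 (hT ht)
        nlinarith
      have h3 := norm_sub_norm_le b ((6 * d * N : ℝ) • t)
      nlinarith
    obtain ⟨j, hj⟩ := hfar
    obtain ⟨k, σ, hσ, hcross⟩ := exists_tubeCross_of_joinedIn (by linarith)
      (hab.mono inter_subset_left) hnear hj
    simp only [mem_iUnion]
    exact ⟨t, hfin.mem_toFinset.2 ht, k, Finset.mem_univ k, σ, hσ, hcross⟩
  calc μ {c | Arm 0 (6 * d * N) c}
      ≤ ∑ t ∈ hfin.toFinset, ∑ j : Fin d, ∑ σ ∈ ({1, -1} : Finset ℝ),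
          μ {c : Configuration (Grain d) | TubeCross ((6 * d * N : ℝ) • t) j σ N c} :=
        (measure_mono hsub).trans ((measure_biUnion_finset_le _ _).trans
          (Finset.sum_le_sum fun _ _ => (measure_biUnion_finset_le _ _).trans
            (Finset.sum_le_sum fun _ _ => measure_biUnion_finset_le _ _)))
    _ ≤ ∑ _t ∈ hfin.toFinset, ∑ _j : Fin d, ∑ _σ ∈ ({1, -1} : Finset ℝ),
          μ {c | BoxConnects N c} :=
        Finset.sum_le_sum fun t _ => Finset.sum_le_sum fun j _ => Finset.sum_le_sum fun σ hσ =>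
          measure_tubeCross_le h _ j (by simpa using hσ) N
    _ = _ := by
        have hcard : ({1, -1} : Finset ℝ).card = 2 := Finset.card_pair (by norm_num)
        simp only [Finset.sum_const, nsmul_eq_mul, hcard, Finset.card_univ, Fintype.card_fin]
        push_cast
        ring

end Law

/-! ### Vanishing of the error term and conclusion -/

lemma tendsto_intensity_nearGrains {lam : ℝ} {ρ : Measure ℝ≥0} {a m : ℝ}
    (hfin : intensity d lam ρ (nearGrains d a m) ≠ ∞)
    {u : ℕ → ℝ} (hu0 : u 0 = m) (hu : Monotone u) (hlim : Tendsto u atTop atTop) :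
    Tendsto (fun n => intensity d lam ρ (nearGrains d a (u n))) atTop (𝓝 0) := by
  have hanti : Antitone fun n => nearGrains d a (u n) :=
    fun n k hnk p hp => ⟨(hu hnk).trans hp.1, hp.2⟩
  have := tendsto_measure_iInter_atTop (μ := intensity d lam ρ)
    (fun n => (measurableSet_nearGrains a (u n)).nullMeasurableSet) hanti
    ⟨0, by simpa only [hu0] using hfin⟩
  have hempty : ⋂ n, nearGrains d a (u n) = ∅ := by
    refine eq_empty_of_forall_notMem fun p hp => ?_
    obtain ⟨n, hn⟩ := (hlim.eventually_gt_atTop (p.2 : ℝ)).exists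
    exact hn.not_ge (mem_iInter.1 hp n).1
  rwa [hempty, measure_empty] at this

lemma arm_of_volume_cluster_eq_top {c : Set (Grain d)} {y : EuclideanSpace ℝ (Fin d)} {m : ℝ}
    (hm : 0 < m) (hy : dist y 0 < m) (hvol : volume (cluster (occupied c) y) = ∞) :
    Arm 0 m c := by
  have hnot : ¬ cluster (occupied c) y ⊆ Metric.ball 0 (3 * m) := fun hsub =>
    ((measure_mono hsub).trans_lt measure_ball_lt_top).ne hvol
  obtain ⟨b, hb, hbm⟩ := not_subset.1 hnot
  exact arm_of_joinedIn hm (show JoinedIn (occupied c) y b from hb) inter_subset_left hy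
    (by simpa using hbm)

end BooleanModel

open BooleanModel in
theorem lemma2p3 (d : ℕ) [NeZero d] (C : ℝ) (hC : 0 < C) :
    ∃ ε : ℝ, 0 < ε ∧
      ∀ (N : ℕ), 1 ≤ N → ∀ (lam : ℝ), 0 < lam →
      ∀ (ρ : Measure ℝ≥0) [IsProbabilityMeasure ρ],
      (∃ R₀ : ℝ, 0 < R₀ ∧ ∀ R : ℝ≥0, R₀ ≤ (R : ℝ) →
        ρ (Set.Ici R) ≤ ENNReal.ofReal (Real.exp (-C * (R : ℝ)))) →
      ∀ {Ω : Type*} [MeasurableSpace Ω] (P : Measure Ω) [IsProbabilityMeasure P]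
        (χ : Ω → Set (EuclideanSpace ℝ (Fin d) × ℝ≥0)),
      BooleanModel.IsPoissonPointProcess P (BooleanModel.intensity d lam ρ) χ →
      P {ω | BooleanModel.Cross (BooleanModel.occupied (χ ω)) (BooleanModel.sides d N)}
        ≤ ENNReal.ofReal ε →
      P {ω | ∃ y : EuclideanSpace ℝ (Fin d),
        volume (BooleanModel.cluster (BooleanModel.occupied (χ ω)) y) = ∞} = 0 := by
  have hd : (1 : ℝ) ≤ d := by exact_mod_cast NeZero.one_le
  obtain ⟨T, hT1, hT⟩ := exists_net_sphere d
  obtain ⟨L, hL⟩ := exists_measure_arm_le_card_mul d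
  -- The recursion runs with `δ = κ * ε`: `L` absorbs the initial arm probability, and `4 * 62 ^ d`
  -- makes the large-grain term `62 ^ d * (2 * ε)` at most `δ / 2`.
  set κ : ℝ := L + 4 * 62 ^ d with hκ
  have hκ0 : 0 < κ := by positivity
  set K : ℝ := (T.card : ℝ) ^ 2 with hK
  have hK0 : 0 ≤ K := by positivity
  refine ⟨1 / (2 * (K * κ + 1)), by positivity, ?_⟩
  -- This gives `K * δ ≤ 1 / 2`; the summand `1` also ensures `ε ≤ 1 / 2`.
  set ε : ℝ := 1 / (2 * (K * κ + 1)) with hε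
  have hε0 : 0 < ε := by positivity
  have hKκ : 0 ≤ K * κ := by positivity
  have hεmul : ε * (K * κ + 1) = 1 / 2 := by rw [hε]; field_simp
  have hε2 : ε ≤ 1 / 2 := by nlinarith
  intro N hN lam _ ρ _ _ Ω _ P _ χ hχ hcross
  have hN' : (1 : ℝ) ≤ N := by exact_mod_cast hN
  set F : Ω → Configuration (Grain d) := fun ω => χ ω with hF
  have hFm : Measurable F := hχ.measurable
  set μ : Measure (Configuration (Grain d)) := P.map F with hμ
  have hvoid : HasPoissonVoids μ (intensity d lam ρ) := hχ.hasPoissonVoids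
  have := hvoid.isProbabilityMeasure
  -- The crossing event enters only through measurable events that imply it, so its own
  -- measurability plays no role.
  have hμcross : ∀ s : Set (Configuration (Grain d)), MeasurableSet s →
      (∀ c ∈ s, Cross (occupied (show Set (Grain d) from c)) (sides d N)) →
      μ s ≤ ENNReal.ofReal ε := fun s hs hsc => by
    rw [hμ, Measure.map_apply hFm hs]
    have hsub : F ⁻¹' s ⊆ {ω | Cross (occupied (χ ω)) (sides d N)} := fun ω hω => hsc _ hω
    exact (measure_mono hsub).trans hcross
  have hbase : μ {c | Arm 0 (6 * d * N) c} ≤ ENNReal.ofReal (L * ε) := by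
    refine (hL μ lam ρ hvoid N hN).trans ?_
    rw [ENNReal.ofReal_mul (Nat.cast_nonneg L), ENNReal.ofReal_natCast]
    gcongr
    exact hμcross _ (measurableSet_boxConnects N) fun c hc => cross_of_boxConnects hc
  have hnear : intensity d lam ρ (nearGrains d 31 (6 * d * N)) ≤
      ENNReal.ofReal (62 ^ d * (2 * ε)) := by
    have hhalf : intensity d lam ρ (nearGrains d (1 / 2) (6 * d * N)) ≤
        ENNReal.ofReal (2 * ε) := by
      refine le_of_one_sub_voidProb_le hε2 ?_
      rw [← hvoid.apply_compl_voidEvent (measurableSet_nearGrains _ _)]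
      refine hμcross _ (measurableSet_voidEvent (measurableSet_nearGrains _ _)).compl ?_
      intro c hc
      obtain ⟨p, hp, hpN⟩ := mem_compl_voidEvent.1 hc
      exact cross_of_mem_nearGrains hN hp hpN
    rw [intensity_nearGrains lam ρ (show (0 : ℝ) < 31 by norm_num),
      show (31 : ℝ) ^ d = 62 ^ d * (1 / 2) ^ d by rw [← mul_pow]; norm_num,
      ENNReal.ofReal_mul (by positivity), mul_assoc,
      ← intensity_nearGrains lam ρ (show (0 : ℝ) < 1 / 2 by norm_num),
      ENNReal.ofReal_mul (by positivity)]
    gcongr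
  set u : ℕ → ℝ := fun n => 6 * d * N * 10 ^ n with hu
  have hu0 : u 0 = 6 * d * N := by simp [hu]
  have hupos : ∀ n, 0 < u n := fun n => by positivity
  have humono : Monotone u := fun n k hnk => by
    simp only [hu]
    gcongr
    norm_num
  have hulim : Tendsto u atTop atTop :=
    (tendsto_pow_atTop_atTop_of_one_lt (by norm_num)).const_mul_atTop (by positivity)
  have hnear' : ∀ n, intensity d lam ρ (nearGrains d 31 (u n)) ≤
      ENNReal.ofReal (62 ^ d * (2 * ε)) := fun n => by
    have hsub : nearGrains d 31 (u n) ⊆ nearGrains d 31 (6 * d * N) := fun p hp =>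
      ⟨(hu0.symm.le.trans (humono n.zero_le)).trans hp.1, hp.2⟩
    exact (measure_mono hsub).trans hnear
  have hnear_top : ∀ n, intensity d lam ρ (nearGrains d 31 (u n)) ≠ ∞ := fun n =>
    ((hnear' n).trans_lt ENNReal.ofReal_lt_top).ne
  have hlim : Tendsto (fun n => (μ {c | Arm 0 (u n) c}).toReal) atTop (𝓝 0) := by
    refine tendsto_zero_of_quadratic_recursion (δ := κ * ε)
      (g := fun n => (intensity d lam ρ (nearGrains d 31 (u n))).toReal) hK0 (by nlinarith)
      (fun n => ENNReal.toReal_nonneg) ?_ ?_ ?_ ?_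
    · rw [hu0]
      refine (ENNReal.toReal_le_of_le_ofReal (by positivity) hbase).trans ?_
      gcongr
      rw [hκ]
      linarith [show (0 : ℝ) < 62 ^ d by positivity]
    · intro n
      refine (ENNReal.toReal_le_of_le_ofReal (by positivity) (hnear' n)).trans ?_
      rw [hκ]
      nlinarith [mul_nonneg (Nat.cast_nonneg (α := ℝ) L) hε0.le]
    · intro n
      have hstep := measure_arm_step hvoid (hupos n) hT1 hT
      have hsucc : u (n + 1) = 10 * u n := by simp only [hu]; ring
      rw [hsucc, hK]
      have htop : (T.card : ℝ≥0∞) ^ 2 * μ {c | Arm 0 (u n) c} ^ 2 ≠ ∞ := by finiteness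
      refine (ENNReal.toReal_mono (ENNReal.add_ne_top.2 ⟨hnear_top n, htop⟩) hstep).trans_eq ?_
      rw [ENNReal.toReal_add (hnear_top n) htop]
      simp
    · have := tendsto_intensity_nearGrains (hnear.trans_lt ENNReal.ofReal_lt_top).ne hu0 humono
        hulim
      exact (ENNReal.tendsto_toReal ENNReal.zero_ne_top).comp this
  have hlim' : Tendsto (fun n => μ {c | Arm 0 (u n) c}) atTop (𝓝 0) :=
    (ENNReal.tendsto_toReal_iff (fun n => measure_ne_top μ _) ENNReal.zero_ne_top).1
      (by simpa using hlim)
  have hsub : {ω | ∃ y : EuclideanSpace ℝ (Fin d), volume (cluster (occupied (χ ω)) y) = ∞} ⊆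
      ⋃ M : ℕ, {ω | ∃ y : EuclideanSpace ℝ (Fin d), dist y 0 < M ∧
        volume (cluster (occupied (χ ω)) y) = ∞} := by
    rintro ω ⟨y, hy⟩
    obtain ⟨M, hM⟩ := exists_nat_gt (dist y 0)
    exact mem_iUnion.2 ⟨M, y, hM, hy⟩
  refine measure_mono_null hsub (measure_iUnion_null fun M => ?_)
  -- For fixed `M`, the event implies an arm at every scale `u n ≥ M`.
  refine le_antisymm (ge_of_tendsto hlim' ?_) zero_le
  filter_upwards [hulim.eventually_ge_atTop (M : ℝ)] with n hn
  rw [hμ, Measure.map_apply hFm (measurableSet_arm 0 (u n))]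
  refine measure_mono ?_
  rintro ω ⟨y, hyM, hy⟩
  exact arm_of_volume_cluster_eq_top (hupos n) (hyM.trans_le hn) hy
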